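/- For $\lambda\in(\tfrac12,1)$ let $I_\lambda=\big[\tfrac{-\lambda}{1-\lambda},\tfrac{\lambda}{1-\lambda}\big]$, and let $T_0,T_1:I_\lambda\to I_\lambda$ be $T_0(x)=\lambda x-\lambda$, $T_1(x)=\lambda x+\lambda$; for a word $\omega=\omega_1\cdots\omega_\ell\in\{0,1\}^\ell$ put $T_\omega=T_{\omega_1}\circ\dots\circ T_{\omega_\ell}$. For $\varphi:I_\lambda\to\mathbb R$ put $\lVert\varphi\rVert_{\mathrm{BV}}=\sup_{I_\lambda}|\varphi|+\operatorname{var}(\varphi,I_\lambda)$, where $\operatorname{var}(\varphi,I_\lambda)$ is the supremum of $\sum_{j=1}^p|\varphi(x_j)-\varphi(x_{j-1})|$ over all $x_0<x_1<\dots<x_p$ in $I_\lambda$, and let $\mathrm{BV}(I_\lambda)$ be the set of functions for which this is finite. Let $\mu_0$ be the Bernoulli convolution of parameter $\lambda$, i.e. the law of $\sum_{k\ge1}\epsilon_k\lambda^k$ for independent $\epsilon_k$ taking the values $1$ and $-1$ with probability $\tfrac12$ each. Let $\lambda\in(\tfrac12,1)$, let $\ell\ge 0$ be an integer with $\lambda^\ell<\tfrac12$,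 and let $(X_k)_{k\ge0}$ be a Markov chain on $I_\lambda$ which jumps from $x$ to $T_\omega(x)$ with probability $2^{-\ell}$ for each word $\omega\in\{0,1\}^\ell$ (probabilities of coinciding images being added), with arbitrary starting law $X_0\sim\mu$. Then $\mu_0$ is the unique stationary probability measure of this chain on $I_\lambda$, and for every $\varphi\in\mathrm{BV}(I_\lambda)$, every real $a$ with $0<a<\dfrac{\lVert\varphi\rVert_{\mathrm{BV}}}{3(2^{\ell+1}-1)}$ and every integer $n\ge120\cdot2^\ell$, $$\mathbb P_\mu\Big[\Big|\frac1n\sum_{k=1}^n\varphi(X_k)-\int\varphi\,d\mu_0\Big|\ge a\Big]\le 2.488\,\exp\Big(-\frac{n a^2}{\lVert\varphi\rVert_{\mathrm{BV}}^2\,(16.65\cdot2^\ell+5.12)}\Big).$$ -/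

import Mathlib

open MeasureTheory ProbabilityTheory
open scoped ENNReal

namespace BernoulliChain

/-- The interval `I_lam = [-lam / (1 - lam), lam / (1 - lam)]`. -/
abbrev interval (lam : Set.Ioo (0 : ℝ) 1) : Set ℝ :=
  Set.Icc (-(lam : ℝ) / (1 - lam)) ((lam : ℝ) / (1 - lam))

/-- A letter, read as a sign: `false` (the letter `0`) is `-1`, `true` (the letter `1`) is `1`. -/
def sign (b : Bool) : ℝ := if b then 1 else -1

theorem abs_sign (b : Bool) : |sign b| = 1 := by cases b <;> simp [sign]

theorem mem_interval_iff (lam : Set.Ioo (0 : ℝ) 1) (x : ℝ) :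
    x ∈ interval lam ↔ |x| ≤ (lam : ℝ) / (1 - lam) := by
  rw [abs_le, Set.mem_Icc, neg_div]

theorem affine_mem (lam : Set.Ioo (0 : ℝ) 1) (b : Bool) {x : ℝ} (hx : x ∈ interval lam) :
    (lam : ℝ) * x + sign b * lam ∈ interval lam := by
  have h0 : (0 : ℝ) < lam := lam.2.1
  have h1 : (0 : ℝ) < 1 - lam := sub_pos.2 lam.2.2
  rw [mem_interval_iff] at hx ⊢
  calc |(lam : ℝ) * x + sign b * lam| ≤ |(lam : ℝ) * x| + |sign b * lam| := abs_add_le _ _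
    _ = lam * |x| + lam := by rw [abs_mul, abs_mul, abs_sign, abs_of_pos h0, one_mul]
    _ ≤ lam * ((lam : ℝ) / (1 - lam)) + lam := by gcongr
    _ = (lam : ℝ) / (1 - lam) := by field_simp; ring

/-- The two maps of the iterated function system on `I_lam`:
`T_0 x = lam * x - lam` (`b = false`) and `T_1 x = lam * x + lam` (`b = true`). -/
def letterMap (lam : Set.Ioo (0 : ℝ) 1) (b : Bool) (x : interval lam) : interval lam :=
  ⟨(lam : ℝ) * x + sign b * lam, affine_mem lam b x.2⟩

/-- `T_w = T_{w 0} ∘ T_{w 1} ∘ ⋯ ∘ T_{w (l - 1)}` for a word `w` of length `l`. -/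
def wordMap (lam : Set.Ioo (0 : ℝ) 1) {l : ℕ} (w : Fin l → Bool) (x : interval lam) :
    interval lam :=
  (List.ofFn w).foldr (letterMap lam) x

theorem continuous_letterMap (lam : Set.Ioo (0 : ℝ) 1) (b : Bool) :
    Continuous (letterMap lam b) := by
  unfold letterMap
  fun_prop

theorem continuous_wordMap (lam : Set.Ioo (0 : ℝ) 1) {l : ℕ} (w : Fin l → Bool) :
    Continuous (wordMap lam w) := by
  unfold wordMap
  induction List.ofFn w with
  | nil => exact continuous_id
  | cons b t ih => exact (continuous_letterMap lam b).comp ih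

/-- The transition kernel that jumps from `x` to `T_w x` with probability `2 ^ (-l)` for each
word `w` of length `l`. -/
noncomputable def kernel (lam : Set.Ioo (0 : ℝ) 1) (l : ℕ) :
    Kernel (interval lam) (interval lam) where
  toFun x := ∑ w : Fin l → Bool, ((2 : ℝ≥0∞) ^ l)⁻¹ • Measure.dirac (wordMap lam w x)
  measurable' := by
    refine Measure.measurable_of_measurable_coe _ fun s hs => ?_
    simp only [Measure.coe_finsetSum, Measure.coe_smul, Finset.sum_apply, Pi.smul_apply]
    refine Finset.measurable_sum _ fun w _ => ?_
    simp only [smul_eq_mul]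
    refine Measurable.const_mul ?_ _
    exact (Measure.measurable_coe hs).comp
      (Measure.measurable_dirac.comp (continuous_wordMap lam w).measurable)

instance (lam : Set.Ioo (0 : ℝ) 1) (l : ℕ) : IsMarkovKernel (kernel lam l) := by
  refine ⟨fun x => ⟨?_⟩⟩
  change (∑ w : Fin l → Bool, ((2 : ℝ≥0∞) ^ l)⁻¹ • Measure.dirac (wordMap lam w x)) Set.univ = 1
  simp only [Measure.coe_finsetSum, Measure.coe_smul, Finset.sum_apply, Pi.smul_apply,
    measure_univ, smul_eq_mul, mul_one, Finset.sum_const, Finset.card_univ, Fintype.card_fun,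
    Fintype.card_bool, Fintype.card_fin, nsmul_eq_mul, Nat.cast_pow, Nat.cast_ofNat]
  exact ENNReal.mul_inv_cancel (by simp) (by simp)

theorem summable_series (lam : Set.Ioo (0 : ℝ) 1) (e : ℕ → Bool) :
    Summable fun k : ℕ => |sign (e k) * (lam : ℝ) ^ (k + 1)| := by
  have h0 : (0 : ℝ) < lam := lam.2.1
  simp only [abs_mul, abs_sign, one_mul, abs_pow, abs_of_pos h0, pow_succ]
  exact (summable_geometric_of_lt_one h0.le lam.2.2).mul_right _

theorem series_mem (lam : Set.Ioo (0 : ℝ) 1) (e : ℕ → Bool) :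
    ∑' k : ℕ, sign (e k) * (lam : ℝ) ^ (k + 1) ∈ interval lam := by
  have h0 : (0 : ℝ) < lam := lam.2.1
  have hk : ∀ k : ℕ, |sign (e k) * (lam : ℝ) ^ (k + 1)| = (lam : ℝ) ^ k * lam := fun k => by
    rw [abs_mul, abs_sign, one_mul, abs_pow, abs_of_pos h0, pow_succ]
  have hsum : ∑' k : ℕ, |sign (e k) * (lam : ℝ) ^ (k + 1)| = (lam : ℝ) / (1 - lam) := by
    rw [tsum_congr hk, tsum_mul_right, tsum_geometric_of_lt_one h0.le lam.2.2, div_eq_inv_mul]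
  rw [mem_interval_iff, ← hsum]
  have h := norm_tsum_le_tsum_norm (f := fun k : ℕ => sign (e k) * (lam : ℝ) ^ (k + 1))
    (summable_series lam e)
  simpa only [Real.norm_eq_abs] using h

/-- The sum `∑_{k ≥ 1} ε_k lam ^ k`, where `ε_{k + 1}` is the sign of `e k`. -/
noncomputable def series (lam : Set.Ioo (0 : ℝ) 1) (e : ℕ → Bool) : interval lam :=
  ⟨∑' k : ℕ, sign (e k) * (lam : ℝ) ^ (k + 1), series_mem lam e⟩

theorem measurable_series (lam : Set.Ioo (0 : ℝ) 1) : Measurable (series lam) := by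
  refine Measurable.subtype_mk ?_
  have hs : Measurable sign := measurable_from_top
  refine measurable_of_tendsto_metrizable (f := fun (n : ℕ) (e : ℕ → Bool) =>
    ∑ k ∈ Finset.range n, sign (e k) * (lam : ℝ) ^ (k + 1)) (fun n => ?_) ?_
  · fun_prop
  · rw [tendsto_pi_nhds]
    exact fun e => (summable_series lam e).of_abs.hasSum.tendsto_sum_nat

/-- A fair coin. -/
noncomputable def coin : Measure Bool := (PMF.uniformOfFintype Bool).toMeasure

instance : IsProbabilityMeasure coin := by unfold coin; infer_instance

/-- The Bernoulli convolution of parameter `lam`: the law, on `I_lam`, of `∑_{k ≥ 1} ε_k lam ^ k`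
for independent fair signs `ε_k`. -/
noncomputable def bernoulliConvolution (lam : Set.Ioo (0 : ℝ) 1) : Measure (interval lam) :=
  (Measure.infinitePi fun _ : ℕ => coin).map (series lam)

instance (lam : Set.Ioo (0 : ℝ) 1) : IsProbabilityMeasure (bernoulliConvolution lam) :=
  Measure.isProbabilityMeasure_map (measurable_series lam).aemeasurable

/-- `X` is, under `P`, a (time-homogeneous) Markov chain with initial law `μ` and transition
kernel `κ`: given `(X_0, …, X_k)`, the conditional law of `X_{k+1}` is `κ X_k`. -/
structure IsMarkovChain {Ω E : Type*} [MeasurableSpace Ω] [MeasurableSpace E]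
    (X : ℕ → Ω → E) (μ : Measure E) (κ : Kernel E E) (P : Measure Ω) : Prop where
  measurable : ∀ k, Measurable (X k)
  initial : HasLaw (X 0) μ P
  transition : ∀ k : ℕ,
    HasCondDistrib (X (k + 1)) (fun (ω : Ω) (i : Finset.Iic k) => X i ω)
      (κ.comap (fun x : Finset.Iic k → E => x ⟨k, Finset.mem_Iic.2 le_rfl⟩)
        (measurable_pi_apply _)) P

/-- The norm `‖f‖_∞ + var(f, I)` of a function `f` of bounded variation on `I`. -/
noncomputable def bvNorm {I : Set ℝ} (f : I → ℝ) : ℝ :=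
  (⨆ x, |f x|) + (eVariationOn f Set.univ).toReal

end BernoulliChain

namespace BernoulliChain

/-! Let L average over the words, V = var φ, N = ‖φ‖_BV and m = ∫φ dμ₀. Since λ^l < 1/2, the images
of the two constant words lie on opposite sides of 0, so together they contribute at most one V to
the variation of Lφ: L contracts variation by 1 - 2^{-l} (`eVariationOn_average_le`). Hence L^k φ
converges uniformly to the integral of φ against any stationary law, which gives uniqueness, and g =
Σ_k (L^k φ - m) solves the Poisson equation g - Lg = φ - m with |g| ≤ 2^l V
(`exists_sub_average_eq`). Stationarity of μ₀ is self-similarity: prepending a fair coin to a fair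
coin sequence preserves its law.

For concentration put G = t g, ε = t 2^l N and u = LG - (1/2 + 2ε) G². The mean of exp(Σ_{k≤n} (G -
LG)(X_k) + u(X_n)) grows by at most a factor e^c per step (`average_exp_sub_sq_le`). The quadratic
term in u leaves G² - (LG)² in c; this has the factor G - LG = t(φ - m), of size tN rather than ε,
so c has leading term t²N²2^l instead of t²N²4^l. Markov's inequality for g and for -g, with t
proportional to a, concludes. -/

/-! ### Second-order bounds for 1 + y. -/

theorem abs_log_one_add_sub_le {y : ℝ} (hy : |y| ≤ 1 / 2) :
    |Real.log (1 + y) - (y - y ^ 2 / 2)| ≤ 2 * |y| * y ^ 2 := by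
  have h := Real.abs_log_sub_add_sum_range_le (x := -y) (by rw [abs_neg]; linarith) 2
  simp only [Finset.sum_range_succ, Finset.sum_range_zero, abs_neg, sub_neg_eq_add] at h
  have h2 : |y| ^ (2 + 1) / (1 - |y|) ≤ 2 * |y| * y ^ 2 := by
    rw [div_le_iff₀ (by linarith), ← sq_abs y]
    have : 0 ≤ |y| ^ 3 * (1 - 2 * |y|) := mul_nonneg (by positivity) (by linarith)
    linarith [this, show 2 * |y| * |y| ^ 2 * (1 - |y|) - |y| ^ (2 + 1)
      = |y| ^ 3 * (1 - 2 * |y|) by ring]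
  refine le_trans (le_of_eq ?_) (h.trans h2)
  congr 1
  norm_num
  ring

/-- The cubic Taylor remainder 2|y|³ is at most 2ε y², so it is absorbed in the quadratic
coefficient; likewise in the reverse bound below. -/
theorem exp_sub_sq_le_one_add {ε y : ℝ} (hε : ε ≤ 1 / 2) (hy : |y| ≤ ε) :
    Real.exp (y - (1 / 2 + 2 * ε) * y ^ 2) ≤ 1 + y := by
  have h := (abs_le.1 (abs_log_one_add_sub_le (hy.trans hε))).1
  have hpos : 0 < 1 + y := by linarith [(abs_le.1 (hy.trans hε)).1]
  rw [← Real.le_log_iff_exp_le hpos]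
  nlinarith [mul_le_mul_of_nonneg_right hy (sq_nonneg y)]

theorem one_add_le_exp_sub_sq {ε y : ℝ} (hε : ε ≤ 1 / 2) (hy : |y| ≤ ε) :
    1 + y ≤ Real.exp (y - (1 / 2 - 2 * ε) * y ^ 2) := by
  have h := (abs_le.1 (abs_log_one_add_sub_le (hy.trans hε))).2
  have hpos : 0 < 1 + y := by linarith [(abs_le.1 (hy.trans hε)).1]
  rw [← Real.log_le_iff_le_exp hpos]
  nlinarith [mul_le_mul_of_nonneg_right hy (sq_nonneg y)]

/-! ### Exponential moments along a Markov chain. -/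

/-- Conditioning on the past up to time n integrates the last factor against the kernel, where the
hypothesis trades it for the potential at X_n and a factor e^c. -/
theorem IsMarkovChain.lintegral_exp_sum_add_le {Ω E : Type*} [MeasurableSpace Ω]
    [MeasurableSpace E] {X : ℕ → Ω → E} {μ : Measure E} {κ : Kernel E E} [IsMarkovKernel κ]
    {P : Measure Ω} [IsProbabilityMeasure P] (hX : IsMarkovChain X μ κ P) {w u : E → ℝ}
    (hw : Measurable w) (hu : Measurable u) {c : ℝ}
    (h : ∀ x, ∫⁻ y, ENNReal.ofReal (Real.exp (w y + u y)) ∂(κ x)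
      ≤ ENNReal.ofReal (Real.exp (u x + c))) (n : ℕ) :
    ∫⁻ ω, ENNReal.ofReal (Real.exp (∑ k ∈ Finset.Icc 1 n, w (X k ω) + u (X n ω))) ∂P
      ≤ ENNReal.ofReal (Real.exp (n * c)) *
        ∫⁻ ω, ENNReal.ofReal (Real.exp (u (X 0 ω))) ∂P := by
  induction n with
  | zero => simp
  | succ n ih =>
    set past : Ω → Finset.Iic n → E := fun ω i => X i ω with hpast
    have hpastm : Measurable past := measurable_pi_lambda _ fun i => hX.measurable i
    let last : (Finset.Iic n → E) → E := fun x => x ⟨n, Finset.mem_Iic.2 le_rfl⟩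
    have hlast : Measurable last := measurable_pi_apply _
    have htr := hX.transition n
    -- The partial sum as a function of the past; the condition drops time 0, which the past
    -- contains.
    let S : (Finset.Iic n → E) → ℝ := fun x => ∑ k : Finset.Iic n, if 1 ≤ (k : ℕ) then w (x k) else 0
    have hS : Measurable S := by
      refine Finset.measurable_sum _ fun k _ => ?_
      split_ifs
      · exact hw.comp (measurable_pi_apply _)
      · exact measurable_const
    have hSX : ∀ ω, S (past ω) = ∑ k ∈ Finset.Icc 1 n, w (X k ω) := fun ω => by
      have h1 : S (past ω) = ∑ k ∈ Finset.Iic n, if 1 ≤ k then w (X k ω) else 0 :=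
        Finset.sum_coe_sort (Finset.Iic n) fun k => if 1 ≤ k then w (X k ω) else 0
      rw [h1, ← Finset.sum_filter]
      congr 1
      ext k
      simp [and_comm]
    let F : (Finset.Iic n → E) × E → ℝ≥0∞ := fun p =>
      ENNReal.ofReal (Real.exp (S p.1)) * ENNReal.ofReal (Real.exp (w p.2 + u p.2))
    have hF : Measurable F := by fun_prop
    have hκ : Measurable fun x => ∫⁻ y, ENNReal.ofReal (Real.exp (w y + u y)) ∂(κ x) :=
      Measurable.lintegral_kernel (by fun_prop)
    calc ∫⁻ ω, ENNReal.ofReal (Real.exp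
          (∑ k ∈ Finset.Icc 1 (n + 1), w (X k ω) + u (X (n + 1) ω))) ∂P
        = ∫⁻ ω, F (past ω, X (n + 1) ω) ∂P := by
          refine lintegral_congr fun ω => ?_
          simp only [F]
          rw [hSX, ← ENNReal.ofReal_mul (Real.exp_nonneg _), ← Real.exp_add,
            Finset.sum_Icc_succ_top (by omega), add_assoc]
      _ = ∫⁻ p, F p ∂(P.map fun ω => (past ω, X (n + 1) ω)) :=
          (lintegral_map hF (hpastm.prodMk (hX.measurable _))).symm
      _ = ∫⁻ ω, ENNReal.ofReal (Real.exp (S (past ω))) *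
            ∫⁻ y, ENNReal.ofReal (Real.exp (w y + u y)) ∂(κ (X n ω)) ∂P := by
          rw [htr.map_eq, Measure.lintegral_compProd hF, lintegral_map ?_ hpastm]
          · refine lintegral_congr fun ω => ?_
            simp only [F]
            rw [lintegral_const_mul _ (by fun_prop), Kernel.comap_apply]
          · exact Measurable.lintegral_kernel_prod_right hF
      _ ≤ ∫⁻ ω, ENNReal.ofReal (Real.exp c) * ENNReal.ofReal
            (Real.exp (∑ k ∈ Finset.Icc 1 n, w (X k ω) + u (X n ω))) ∂P := by
          refine lintegral_mono fun ω => ?_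
          refine (mul_le_mul_right (h _) _).trans (le_of_eq ?_)
          rw [hSX, ← ENNReal.ofReal_mul (Real.exp_nonneg _),
            ← ENNReal.ofReal_mul (Real.exp_nonneg _), ← Real.exp_add, ← Real.exp_add]
          congr 2
          ring
      _ ≤ ENNReal.ofReal (Real.exp c) * (ENNReal.ofReal (Real.exp (n * c)) *
            ∫⁻ ω, ENNReal.ofReal (Real.exp (u (X 0 ω))) ∂P) := by
          rw [lintegral_const_mul' _ _ ENNReal.ofReal_ne_top]
          gcongr
      _ = _ := by
          rw [← mul_assoc, ← ENNReal.ofReal_mul (Real.exp_nonneg _), ← Real.exp_add]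
          congr 3
          push_cast
          ring

/-- Markov's inequality; the potential u costs U once at time 0 and once at time n. -/
theorem IsMarkovChain.measureReal_le_sum_le_exp {Ω E : Type*} [MeasurableSpace Ω]
    [MeasurableSpace E] {X : ℕ → Ω → E} {μ : Measure E} {κ : Kernel E E} [IsMarkovKernel κ]
    {P : Measure Ω} [IsProbabilityMeasure P] (hX : IsMarkovChain X μ κ P) {w u : E → ℝ}
    (hw : Measurable w) (hu : Measurable u) {c U : ℝ} (hU : ∀ x, |u x| ≤ U)
    (h : ∀ x, ∫⁻ y, ENNReal.ofReal (Real.exp (w y + u y)) ∂(κ x)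
      ≤ ENNReal.ofReal (Real.exp (u x + c))) (n : ℕ) (s : ℝ) :
    P.real {ω | s ≤ ∑ k ∈ Finset.Icc 1 n, w (X k ω)} ≤ Real.exp (2 * U + n * c - s) := by
  have hm : ∀ k, Measurable (X k) := hX.measurable
  have h0 : ∫⁻ ω, ENNReal.ofReal (Real.exp (u (X 0 ω))) ∂P ≤ ENNReal.ofReal (Real.exp U) := by
    refine (lintegral_mono fun ω => ENNReal.ofReal_le_ofReal
      (Real.exp_le_exp.2 (abs_le.1 (hU (X 0 ω))).2)).trans ?_
    simp
  have h1 := (hX.lintegral_exp_sum_add_le hw hu h n).trans (mul_le_mul_right h0 _)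
  rw [← ENNReal.ofReal_mul (Real.exp_nonneg _), ← Real.exp_add] at h1
  have hf : Measurable fun ω => ENNReal.ofReal
      (Real.exp (∑ k ∈ Finset.Icc 1 n, w (X k ω) + u (X n ω))) := by fun_prop
  have h2 := mul_meas_ge_le_lintegral (μ := P) hf (ENNReal.ofReal (Real.exp (s - U)))
  have h3 : P {ω | s ≤ ∑ k ∈ Finset.Icc 1 n, w (X k ω)} ≤ P {ω | ENNReal.ofReal (Real.exp (s - U))
      ≤ ENNReal.ofReal (Real.exp (∑ k ∈ Finset.Icc 1 n, w (X k ω) + u (X n ω)))} := by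
    refine measure_mono fun ω hω => ENNReal.ofReal_le_ofReal (Real.exp_le_exp.2 ?_)
    have := (abs_le.1 (hU (X n ω))).1
    simp only [Set.mem_ofPred_eq] at hω
    linarith
  have h4 := ((mul_le_mul_right h3 _).trans h2).trans h1
  have h5 := ENNReal.toReal_mono ENNReal.ofReal_ne_top h4
  rw [ENNReal.toReal_mul, ENNReal.toReal_ofReal (Real.exp_nonneg _),
    ENNReal.toReal_ofReal (Real.exp_nonneg _), ← le_div_iff₀' (Real.exp_pos _),
    ← Real.exp_sub] at h5
  refine h5.trans (le_of_eq ?_)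
  congr 1
  ring

/-! ### The averaging operator. -/

/-- The averaging operator of the chain. -/
noncomputable def average (lam : Set.Ioo (0 : ℝ) 1) (l : ℕ) (f : interval lam → ℝ)
    (x : interval lam) : ℝ :=
  ((2 : ℝ) ^ l)⁻¹ * ∑ w : Fin l → Bool, f (wordMap lam w x)

theorem lintegral_kernel (lam : Set.Ioo (0 : ℝ) 1) (l : ℕ) (f : interval lam → ℝ≥0∞)
    (x : interval lam) :
    ∫⁻ y, f y ∂(kernel lam l x) = ((2 : ℝ≥0∞) ^ l)⁻¹ * ∑ w : Fin l → Bool, f (wordMap lam w x) := by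
  change ∫⁻ y, f y ∂(∑ w : Fin l → Bool, ((2 : ℝ≥0∞) ^ l)⁻¹ • Measure.dirac (wordMap lam w x)) = _
  simp [lintegral_finsetSum_measure, lintegral_smul_measure, Finset.mul_sum]

theorem lintegral_kernel_ofReal (lam : Set.Ioo (0 : ℝ) 1) (l : ℕ) {f : interval lam → ℝ}
    (hf : ∀ x, 0 ≤ f x) (x : interval lam) :
    ∫⁻ y, ENNReal.ofReal (f y) ∂(kernel lam l x) = ENNReal.ofReal (average lam l f x) := by
  rw [lintegral_kernel, average, ENNReal.ofReal_mul (by positivity),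
    ENNReal.ofReal_sum_of_nonneg fun w _ => hf _, ENNReal.ofReal_inv_of_pos (by positivity),
    ENNReal.ofReal_pow (by norm_num)]
  norm_num

theorem integral_kernel (lam : Set.Ioo (0 : ℝ) 1) (l : ℕ) (f : interval lam → ℝ)
    (x : interval lam) : ∫ y, f y ∂(kernel lam l x) = average lam l f x := by
  change ∫ y, f y ∂(∑ w : Fin l → Bool, ((2 : ℝ≥0∞) ^ l)⁻¹ • Measure.dirac (wordMap lam w x)) = _
  rw [integral_finsetSum_measure]
  · simp [integral_smul_measure, average, Finset.mul_sum]
  · exact fun w _ => (integrable_dirac (by simp)).smul_measure (by simp)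

theorem integral_average {lam : Set.Ioo (0 : ℝ) 1} {l : ℕ} {ν : Measure (interval lam)}
    (hν : (kernel lam l).Invariant ν) {f : interval lam → ℝ} (hf : Integrable f ν) :
    ∫ x, average lam l f x ∂ν = ∫ x, f x ∂ν := by
  have hc : (kernel lam l ∘ₖ Kernel.const Unit ν) () = ν := by
    rw [Kernel.comp_apply, Kernel.const_apply, hν.def]
  have h := Kernel.integral_comp (κ := Kernel.const Unit ν) (η := kernel lam l) (a := ())
    (f := f) (by rwa [hc])
  rw [hc] at h
  simpa only [integral_kernel, Kernel.const_apply] using h.symm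

theorem average_add (lam : Set.Ioo (0 : ℝ) 1) (l : ℕ) (f g : interval lam → ℝ)
    (x : interval lam) : average lam l (fun y => f y + g y) x
      = average lam l f x + average lam l g x := by
  simp only [average, Finset.sum_add_distrib, mul_add]

theorem average_const_mul (lam : Set.Ioo (0 : ℝ) 1) (l : ℕ) (c : ℝ) (f : interval lam → ℝ)
    (x : interval lam) : average lam l (fun y => c * f y) x = c * average lam l f x := by
  simp only [average, ← Finset.mul_sum]
  ring

theorem average_const (lam : Set.Ioo (0 : ℝ) 1) (l : ℕ) (c : ℝ)
    (x : interval lam) : average lam l (fun _ => c) x = c := by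
  simp [average]

theorem average_mono (lam : Set.Ioo (0 : ℝ) 1) (l : ℕ) {f g : interval lam → ℝ}
    (h : ∀ x, f x ≤ g x) (x : interval lam) : average lam l f x ≤ average lam l g x :=
  mul_le_mul_of_nonneg_left (Finset.sum_le_sum fun _ _ => h _) (by positivity)

theorem abs_average_le (lam : Set.Ioo (0 : ℝ) 1) (l : ℕ) {f : interval lam → ℝ} {M : ℝ}
    (h : ∀ x, |f x| ≤ M) (x : interval lam) : |average lam l f x| ≤ M := by
  rw [abs_le]
  exact ⟨(average_const lam l (-M) x).symm.trans_le (average_mono lam l (fun y => (abs_le.1 (h y)).1) x),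
    (average_mono lam l (fun y => (abs_le.1 (h y)).2) x).trans_eq (average_const lam l M x)⟩

theorem measurable_average (lam : Set.Ioo (0 : ℝ) 1) (l : ℕ) {f : interval lam → ℝ}
    (hf : Measurable f) : Measurable (average lam l f) :=
  (Finset.measurable_sum _ fun w _ =>
    hf.comp (continuous_wordMap lam w).measurable).const_mul _

/-! ### Contraction of the variation. -/

theorem monotone_wordMap (lam : Set.Ioo (0 : ℝ) 1) {l : ℕ} (w : Fin l → Bool) :
    Monotone (wordMap lam w) := by
  have hb : ∀ b, Monotone (letterMap lam b) := fun b x y h => by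
    have h0 : (0 : ℝ) < lam := lam.2.1
    have h' : (x : ℝ) ≤ y := h
    change (lam : ℝ) * x + sign b * lam ≤ (lam : ℝ) * y + sign b * lam
    gcongr
  unfold wordMap
  induction List.ofFn w with
  | nil => exact monotone_id
  | cons b t ih => exact (hb b).comp ih

theorem coe_wordMap_const (lam : Set.Ioo (0 : ℝ) 1) (l : ℕ) (b : Bool) (x : interval lam) :
    (wordMap lam (fun _ : Fin l => b) x : ℝ)
      = (lam : ℝ) ^ l * x + sign b * ((lam : ℝ) / (1 - lam) * (1 - (lam : ℝ) ^ l)) := by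
  have h1 : (1 - (lam : ℝ)) ≠ 0 := (sub_pos.2 lam.2.2).ne'
  rw [wordMap, List.ofFn_const]
  induction l with
  | zero => simp
  | succ l ih =>
    rw [List.replicate_succ, List.foldr_cons]
    change (lam : ℝ) * ((List.replicate l b).foldr (letterMap lam) x : interval lam) + sign b * lam = _
    rw [ih]
    field_simp
    ring

theorem wordMap_false_le_wordMap_true {lam : Set.Ioo (0 : ℝ) 1} {l : ℕ}
    (hl : (lam : ℝ) ^ l < 1 / 2) (x y : interval lam) :
    wordMap lam (fun _ : Fin l => false) x ≤ wordMap lam (fun _ : Fin l => true) y := by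
  have h0 : (0 : ℝ) < lam := lam.2.1
  have h1 : (0 : ℝ) < 1 - lam := sub_pos.2 lam.2.2
  have hx := (abs_le.1 ((mem_interval_iff lam x).1 x.2)).2
  have hy := (abs_le.1 ((mem_interval_iff lam y).1 y.2)).1
  rw [← Subtype.coe_le_coe, coe_wordMap_const, coe_wordMap_const]
  simp only [sign, if_true, Bool.false_eq_true, if_false]
  set R := (lam : ℝ) / (1 - lam) with hR
  have hR0 : 0 < R := by positivity
  have hp : 0 < (lam : ℝ) ^ l := by positivity
  nlinarith [mul_le_mul_of_nonneg_left hx hp.le, mul_le_mul_of_nonneg_left hy hp.le]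

/-- Each of the 2^l monotone branches has variation at most V, and the two constant words share a
single V because their images are ordered: in all (2^l - 1) V, before dividing by 2^l. -/
theorem eVariationOn_average_le {lam : Set.Ioo (0 : ℝ) 1} {l : ℕ} (hl : (lam : ℝ) ^ l < 1 / 2)
    (f : interval lam → ℝ) :
    eVariationOn (average lam l f) Set.univ
      ≤ ENNReal.ofReal (1 - ((2 : ℝ) ^ l)⁻¹) * eVariationOn f Set.univ := by
  set V := eVariationOn f Set.univ with hV
  have hl0 : l ≠ 0 := by rintro rfl; norm_num at hl
  have hq : (0 : ℝ) < ((2 : ℝ) ^ l)⁻¹ := by positivity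
  have hedist : ∀ x y, edist (average lam l f x) (average lam l f y)
      ≤ ENNReal.ofReal ((2 : ℝ) ^ l)⁻¹ *
        ∑ w : Fin l → Bool, edist (f (wordMap lam w x)) (f (wordMap lam w y)) := fun x y => by
    rw [edist_eq_enorm_sub, average, average, ← mul_sub, ← Finset.sum_sub_distrib, enorm_mul,
      Real.enorm_eq_ofReal hq.le]
    gcongr
    refine (enorm_sum_le _ _).trans (le_of_eq ?_)
    simp only [edist_eq_enorm_sub]
  have hword : ∀ w : Fin l → Bool, eVariationOn (fun x => f (wordMap lam w x)) Set.univ ≤ V :=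
    fun w => eVariationOn.comp_le_of_monotoneOn f _ ((monotone_wordMap lam w).monotoneOn _)
      (Set.mapsTo_univ _ _)
  have hpair : eVariationOn (fun x => f (wordMap lam (fun _ : Fin l => false) x)) Set.univ
      + eVariationOn (fun x => f (wordMap lam (fun _ : Fin l => true) x)) Set.univ ≤ V := by
    refine (add_le_add
      (eVariationOn.comp_le_of_monotoneOn f _ ((monotone_wordMap lam _).monotoneOn _)
        (Set.mapsTo_range _ _ |>.mono_left (Set.subset_univ _)))
      (eVariationOn.comp_le_of_monotoneOn f _ ((monotone_wordMap lam _).monotoneOn _)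
        (Set.mapsTo_range _ _ |>.mono_left (Set.subset_univ _)))).trans
      ((eVariationOn.add_le_union f ?_).trans (eVariationOn.mono f (Set.subset_univ _)))
    rintro _ ⟨x, rfl⟩ _ ⟨y, rfl⟩
    exact wordMap_false_le_wordMap_true hl x y
  have hne : (fun _ : Fin l => true) ≠ fun _ => false := fun h => by
    simpa using congrFun h ⟨0, Nat.pos_of_ne_zero hl0⟩
  have hsum : ∑ w : Fin l → Bool, eVariationOn (fun x => f (wordMap lam w x)) Set.univ
      ≤ ((2 ^ l - 1 : ℕ) : ℝ≥0∞) * V := by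
    classical
    have h2 : 2 ≤ 2 ^ l := Nat.le_self_pow hl0 2
    rw [← Finset.add_sum_erase _ _ (Finset.mem_univ (fun _ : Fin l => false)),
      ← Finset.add_sum_erase _ _ (Finset.mem_erase.2
        ⟨hne, Finset.mem_univ (fun _ : Fin l => true)⟩), ← add_assoc]
    refine (add_le_add hpair (Finset.sum_le_card_nsmul _ _ V fun w _ => hword w)).trans
      (le_of_eq ?_)
    rw [Finset.card_erase_of_mem (by simpa using hne), Finset.card_erase_of_mem (Finset.mem_univ _),
      Finset.card_univ, Fintype.card_fun, Fintype.card_bool, Fintype.card_fin, nsmul_eq_mul]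
    -- Writing 2^l = 2 + k removes the truncated subtractions.
    obtain ⟨k, hk⟩ := Nat.exists_eq_add_of_le h2
    rw [hk, show 2 + k - 1 - 1 = k by omega, show 2 + k - 1 = k + 1 by omega]
    push_cast
    ring
  have hconst : ENNReal.ofReal (1 - ((2 : ℝ) ^ l)⁻¹)
      = ENNReal.ofReal ((2 : ℝ) ^ l)⁻¹ * ((2 ^ l - 1 : ℕ) : ℝ≥0∞) := by
    rw [← ENNReal.ofReal_natCast, ← ENNReal.ofReal_mul hq.le]
    congr 1
    have h1 : 1 ≤ 2 ^ l := Nat.one_le_two_pow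
    push_cast [h1]
    field_simp
  rw [hconst, mul_assoc]
  refine le_trans ?_ (mul_le_mul_right hsum _)
  refine iSup_le fun p => ?_
  refine (Finset.sum_le_sum fun i _ => hedist _ _).trans ?_
  rw [← Finset.mul_sum, Finset.sum_comm]
  gcongr with w
  exact eVariationOn.sum_le (f := fun x => f (wordMap lam w x)) p.2.2.1 p.2.2.2

theorem eVariationOn_iterate_average_le {lam : Set.Ioo (0 : ℝ) 1} {l : ℕ}
    (hl : (lam : ℝ) ^ l < 1 / 2) (f : interval lam → ℝ) (k : ℕ) :
    eVariationOn ((average lam l)^[k] f) Set.univ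
      ≤ ENNReal.ofReal (1 - ((2 : ℝ) ^ l)⁻¹) ^ k * eVariationOn f Set.univ := by
  induction k with
  | zero => simp
  | succ k ih =>
    rw [Function.iterate_succ_apply', pow_succ', mul_assoc]
    exact (eVariationOn_average_le hl _).trans (mul_le_mul_right ih _)

/-! ### Convergence of the iterates and uniqueness of the stationary law. -/

theorem _root_.BoundedVariationOn.measurable {α : Type*} [LinearOrder α] [TopologicalSpace α]
    [SecondCountableTopology α] [OrderTopology α] [MeasurableSpace α] [BorelSpace α] {f : α → ℝ}
    (hf : BoundedVariationOn f Set.univ) : Measurable f := by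
  obtain ⟨p, q, hp, hq, rfl⟩ := hf.locallyBoundedVariationOn.exists_monotoneOn_sub_monotoneOn
  exact (monotoneOn_univ.1 hp).measurable.sub (monotoneOn_univ.1 hq).measurable

theorem _root_.BoundedVariationOn.integrable {lam : Set.Ioo (0 : ℝ) 1} {f : interval lam → ℝ}
    (hf : BoundedVariationOn f Set.univ) (ν : Measure (interval lam)) [IsProbabilityMeasure ν] :
    Integrable f ν := by
  obtain ⟨x⟩ := nonempty_of_isProbabilityMeasure ν
  refine Integrable.of_bound hf.measurable.aestronglyMeasurable
    (|f x| + (eVariationOn f Set.univ).toReal) (ae_of_all _ fun y => ?_)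
  have h := hf.dist_le (Set.mem_univ y) (Set.mem_univ x)
  rw [Real.dist_eq] at h
  rw [Real.norm_eq_abs]
  linarith [abs_sub_abs_le_abs_sub (f y) (f x)]

theorem abs_sub_integral_le {lam : Set.Ioo (0 : ℝ) 1} {f : interval lam → ℝ}
    (hf : BoundedVariationOn f Set.univ) (ν : Measure (interval lam)) [IsProbabilityMeasure ν]
    (x : interval lam) : |f x - ∫ y, f y ∂ν| ≤ (eVariationOn f Set.univ).toReal := by
  have h : f x - ∫ y, f y ∂ν = ∫ y, (f x - f y) ∂ν := by
    rw [integral_sub (integrable_const _) (hf.integrable ν)]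
    simp
  rw [h, ← Real.norm_eq_abs]
  refine (norm_integral_le_of_norm_le_const (ae_of_all _ fun y => ?_)).trans_eq
    (by rw [probReal_univ, mul_one])
  rw [← dist_eq_norm]
  exact hf.dist_le (Set.mem_univ x) (Set.mem_univ y)

theorem boundedVariationOn_iterate_average {lam : Set.Ioo (0 : ℝ) 1} {l : ℕ}
    (hl : (lam : ℝ) ^ l < 1 / 2) {f : interval lam → ℝ} (hf : BoundedVariationOn f Set.univ)
    (k : ℕ) : BoundedVariationOn ((average lam l)^[k] f) Set.univ :=
  ne_top_of_le_ne_top (ENNReal.mul_ne_top (by simp) hf) (eVariationOn_iterate_average_le hl f k)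

theorem integral_iterate_average {lam : Set.Ioo (0 : ℝ) 1} {l : ℕ}
    (hl : (lam : ℝ) ^ l < 1 / 2) {f : interval lam → ℝ} (hf : BoundedVariationOn f Set.univ)
    {ν : Measure (interval lam)} [IsProbabilityMeasure ν] (hν : (kernel lam l).Invariant ν)
    (k : ℕ) : ∫ x, (average lam l)^[k] f x ∂ν = ∫ x, f x ∂ν := by
  induction k with
  | zero => rfl
  | succ k ih =>
    rw [Function.iterate_succ']
    exact (integral_average hν ((boundedVariationOn_iterate_average hl hf k).integrable ν)).trans ih

theorem abs_iterate_average_sub_integral_le {lam : Set.Ioo (0 : ℝ) 1} {l : ℕ}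
    (hl : (lam : ℝ) ^ l < 1 / 2) {f : interval lam → ℝ} (hf : BoundedVariationOn f Set.univ)
    {ν : Measure (interval lam)} [IsProbabilityMeasure ν] (hν : (kernel lam l).Invariant ν)
    (k : ℕ) (x : interval lam) :
    |(average lam l)^[k] f x - ∫ y, f y ∂ν|
      ≤ (1 - ((2 : ℝ) ^ l)⁻¹) ^ k * (eVariationOn f Set.univ).toReal := by
  have h := abs_sub_integral_le (boundedVariationOn_iterate_average hl hf k) ν x
  rw [integral_iterate_average hl hf hν] at h
  refine h.trans ((ENNReal.toReal_mono (ENNReal.mul_ne_top (by simp) hf)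
    (eVariationOn_iterate_average_le hl f k)).trans_eq ?_)
  rw [ENNReal.toReal_mul, ENNReal.toReal_pow, ENNReal.toReal_ofReal]
  exact sub_nonneg.2 (inv_le_one_of_one_le₀ (one_le_pow₀ one_le_two))

/-- The iterates of a BV function at one point converge to its integral against either law;
indicators of lower rays are BV and determine a probability measure. -/
theorem Invariant.unique {lam : Set.Ioo (0 : ℝ) 1} {l : ℕ} (hl : (lam : ℝ) ^ l < 1 / 2)
    {ν ρ : Measure (interval lam)} [IsProbabilityMeasure ν] [IsProbabilityMeasure ρ]
    (hν : (kernel lam l).Invariant ν) (hρ : (kernel lam l).Invariant ρ) : ν = ρ := by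
  have hint : ∀ f : interval lam → ℝ, BoundedVariationOn f Set.univ →
      ∫ x, f x ∂ν = ∫ x, f x ∂ρ := fun f hf => by
    obtain ⟨x⟩ := nonempty_of_isProbabilityMeasure ν
    have hr0 : (0 : ℝ) ≤ 1 - ((2 : ℝ) ^ l)⁻¹ :=
      sub_nonneg.2 (inv_le_one_of_one_le₀ (one_le_pow₀ one_le_two))
    have hr1 : 1 - ((2 : ℝ) ^ l)⁻¹ < 1 := sub_lt_self _ (by positivity)
    have hlim : Filter.Tendsto (fun k : ℕ => (1 - ((2 : ℝ) ^ l)⁻¹) ^ k *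
        (eVariationOn f Set.univ).toReal) Filter.atTop (nhds 0) := by
      simpa using (tendsto_pow_atTop_nhds_zero_of_lt_one hr0 hr1).mul_const
        (eVariationOn f Set.univ).toReal
    have htend : ∀ (η : Measure (interval lam)) [IsProbabilityMeasure η],
        (kernel lam l).Invariant η → Filter.Tendsto (fun k => (average lam l)^[k] f x)
          Filter.atTop (nhds (∫ y, f y ∂η)) := fun η _ hη =>
      tendsto_iff_norm_sub_tendsto_zero.2 (squeeze_zero (fun _ => norm_nonneg _)
        (fun k => abs_iterate_average_sub_integral_le hl hf hη k x) hlim)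
    exact tendsto_nhds_unique (htend ν hν) (htend ρ hρ)
  refine Measure.ext_of_Iic ν ρ fun a => ?_
  have hanti : Antitone ((Set.Iic a).indicator fun _ => (1 : ℝ)) := fun x y hxy => by
    by_cases hy : y ∈ Set.Iic a
    · rw [Set.indicator_of_mem hy, Set.indicator_of_mem (Set.mem_Iic.2 (hxy.trans hy))]
    · rw [Set.indicator_of_notMem hy]
      exact Set.indicator_nonneg (fun _ _ => zero_le_one) x
  have hBV : BoundedVariationOn ((Set.Iic a).indicator fun _ => (1 : ℝ)) Set.univ := by
    have hneg : BoundedVariationOn (fun x => -(Set.Iic a).indicator (fun _ => (1 : ℝ)) x)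
        Set.univ := by
      refine MonotoneOn.boundedVariationOn (C := 1) (hanti.neg.monotoneOn _) fun x _ => ?_
      rw [abs_neg, Set.indicator_apply]
      split_ifs <;> simp
    unfold BoundedVariationOn eVariationOn at hneg ⊢
    simpa only [edist_neg_neg] using hneg
  have h := hint _ hBV
  rw [integral_indicator_const _ measurableSet_Iic, integral_indicator_const _ measurableSet_Iic,
    smul_eq_mul, smul_eq_mul, mul_one, mul_one] at h
  exact (measureReal_eq_measureReal_iff).1 h

/-! ### Stationarity of the Bernoulli convolution. -/

/-- Prepend a letter to an infinite sequence. -/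
def consSeq (p : Bool × (ℕ → Bool)) (k : ℕ) : Bool :=
  Nat.casesOn k p.1 p.2

theorem measurable_consSeq : Measurable consSeq :=
  measurable_pi_lambda _ fun k => by
    cases k with
    | zero => exact measurable_fst
    | succ k => exact (measurable_pi_apply k).comp measurable_snd

theorem map_consSeq_coin_prod :
    (coin.prod (Measure.infinitePi fun _ : ℕ => coin)).map consSeq
      = Measure.infinitePi fun _ : ℕ => coin := by
  classical
  refine Measure.eq_infinitePi _ fun s t ht => ?_
  obtain ⟨n, hn⟩ := s.exists_nat_subset_range
  -- Padding the cylinder to the coordinates 0, …, n ensures that coordinate 0 is present and can be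
  -- split off.
  let t' : ℕ → Set Bool := fun i => if i ∈ s then t i else Set.univ
  have hpi : (s : Set ℕ).pi t = (Finset.range (n + 1) : Set ℕ).pi t' := by
    ext e
    simp only [Set.mem_pi, Finset.mem_coe, t']
    refine ⟨fun h i _ => ?_, fun h i hi => ?_⟩
    · split_ifs with hi
      · exact h i hi
      · trivial
    · have := h i (Finset.mem_range.2 ((Finset.mem_range.1 (hn hi)).trans n.lt_succ_self))
      rwa [if_pos hi] at this
  have hprod : ∏ i ∈ s, coin (t i) = ∏ i ∈ Finset.range (n + 1), coin (t' i) := by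
    rw [← Finset.prod_subset (hn.trans (Finset.range_mono n.le_succ))]
    · exact Finset.prod_congr rfl fun i hi => by simp only [t', if_pos hi]
    · exact fun i _ hi => by simp only [t', if_neg hi, measure_univ]
  have hpre : consSeq ⁻¹' (Finset.range (n + 1) : Set ℕ).pi t'
      = t' 0 ×ˢ (Finset.range n : Set ℕ).pi fun i => t' (i + 1) := by
    ext ⟨b, e⟩
    simp only [Set.mem_preimage, Set.mem_pi, Finset.coe_range, Set.mem_Iio, Set.mem_prod]
    refine ⟨fun h => ⟨h 0 n.succ_pos, fun i hi => h (i + 1) (Nat.succ_lt_succ hi)⟩,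
      fun h i hi => ?_⟩
    cases i with
    | zero => exact h.1
    | succ i => exact h.2 i (Nat.lt_of_succ_lt_succ hi)
  rw [hpi, hprod, Measure.map_apply measurable_consSeq, hpre, Measure.prod_prod,
    Measure.infinitePi_pi, Finset.prod_range_succ', mul_comm]
  · exact fun i _ => MeasurableSet.of_discrete
  · exact MeasurableSet.pi (Finset.countable_toSet _) fun i _ => MeasurableSet.of_discrete

theorem series_consSeq (lam : Set.Ioo (0 : ℝ) 1) (b : Bool) (e : ℕ → Bool) :
    series lam (consSeq (b, e)) = letterMap lam b (series lam e) := by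
  refine Subtype.ext ?_
  change ∑' k : ℕ, sign (consSeq (b, e) k) * (lam : ℝ) ^ (k + 1)
    = lam * ∑' k : ℕ, sign (e k) * (lam : ℝ) ^ (k + 1) + sign b * lam
  rw [(summable_series lam _).of_abs.tsum_eq_zero_add, ← tsum_mul_left, add_comm]
  congr 1
  · refine tsum_congr fun k => ?_
    change sign (e k) * _ = _
    ring
  · change sign b * _ = _
    ring

theorem lintegral_coin (f : Bool → ℝ≥0∞) : ∫⁻ b, f b ∂coin = 2⁻¹ * ∑ b, f b := by
  have h : ∀ b, coin {b} = 2⁻¹ := fun b => by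
    rw [coin, PMF.toMeasure_apply_singleton _ _ (measurableSet_singleton b),
      PMF.uniformOfFintype_apply]
    simp
  rw [lintegral_fintype, Finset.mul_sum]
  exact Finset.sum_congr rfl fun b _ => by rw [h, mul_comm]

theorem lintegral_bernoulliConvolution (lam : Set.Ioo (0 : ℝ) 1) {f : interval lam → ℝ≥0∞}
    (hf : Measurable f) :
    ∫⁻ x, f x ∂(bernoulliConvolution lam)
      = 2⁻¹ * ∑ b, ∫⁻ x, f (letterMap lam b x) ∂(bernoulliConvolution lam) := by
  have hs := measurable_series lam
  have h : ∀ b, ∫⁻ x, f (letterMap lam b x) ∂(bernoulliConvolution lam)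
      = ∫⁻ e, f (series lam (consSeq (b, e))) ∂(Measure.infinitePi fun _ : ℕ => coin) := fun b => by
    simp only [bernoulliConvolution, series_consSeq]
    exact lintegral_map (hf.comp (continuous_letterMap lam b).measurable) hs
  have hm := hf.comp (hs.comp measurable_consSeq)
  simp only [h]
  rw [← lintegral_coin, bernoulliConvolution, lintegral_map hf hs]
  conv_lhs => rw [← map_consSeq_coin_prod]
  exact (lintegral_map (hf.comp hs) measurable_consSeq).trans (lintegral_prod _ hm.aemeasurable)

theorem wordMap_snoc (lam : Set.Ioo (0 : ℝ) 1) {l : ℕ} (w : Fin l → Bool) (b : Bool)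
    (x : interval lam) : wordMap lam (Fin.snoc (α := fun _ => Bool) w b : Fin (l + 1) → Bool) x
      = wordMap lam w (letterMap lam b x) := by
  rw [wordMap, wordMap, List.ofFn_succ_last, List.foldr_append]
  simp only [Fin.snoc_castSucc, Fin.snoc_last, List.foldr_cons, List.foldr_nil]

theorem lintegral_lintegral_kernel_bernoulliConvolution (lam : Set.Ioo (0 : ℝ) 1) (l : ℕ)
    {f : interval lam → ℝ≥0∞} (hf : Measurable f) :
    ∫⁻ x, ∫⁻ y, f y ∂(kernel lam l x) ∂(bernoulliConvolution lam)
      = ∫⁻ x, f x ∂(bernoulliConvolution lam) := by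
  simp only [lintegral_kernel]
  have hword : ∀ {l : ℕ} (w : Fin l → Bool), Measurable fun x => f (wordMap lam w x) :=
    fun w => hf.comp (continuous_wordMap lam w).measurable
  rw [lintegral_const_mul _ (Finset.measurable_sum _ fun w _ => hword w),
    lintegral_finsetSum _ fun w _ => hword w]
  induction l with
  | zero => simp [wordMap]
  | succ l ih =>
    -- The last letter acts first, so averaging over it is absorbed by the one-letter invariance,
    -- leaving words of length l.
    rw [← ih, ← (Fin.snocEquiv fun _ : Fin (l + 1) => Bool).sum_comp, Fintype.sum_prod_type_right]
    rw [pow_succ, ENNReal.mul_inv (by simp) (by simp), mul_assoc, Finset.mul_sum]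
    congr 1
    refine Finset.sum_congr rfl fun w _ => ?_
    rw [lintegral_bernoulliConvolution lam (hword w)]
    simp only [← wordMap_snoc]
    rfl

theorem invariant_bernoulliConvolution (lam : Set.Ioo (0 : ℝ) 1) (l : ℕ) :
    (kernel lam l).Invariant (bernoulliConvolution lam) := by
  refine Measure.ext fun s hs => ?_
  rw [← lintegral_indicator_one hs, ← lintegral_indicator_one hs,
    Measure.lintegral_bind (kernel lam l).aemeasurable
      (measurable_one.indicator hs).aemeasurable]
  exact lintegral_lintegral_kernel_bernoulliConvolution lam l (measurable_one.indicator hs)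

/-! ### Poisson equation and concentration. -/

/-- The series Σ_k (L^k f - m) converges geometrically with ratio 1 - 2^{-l}, whence the factor 2^l,
and g - Lg telescopes to its first term. -/
theorem exists_sub_average_eq {lam : Set.Ioo (0 : ℝ) 1} {l : ℕ} (hl : (lam : ℝ) ^ l < 1 / 2)
    {f : interval lam → ℝ} (hf : BoundedVariationOn f Set.univ)
    {ν : Measure (interval lam)} [IsProbabilityMeasure ν] (hν : (kernel lam l).Invariant ν) :
    ∃ g : interval lam → ℝ, Measurable g ∧
      (∀ x, |g x| ≤ 2 ^ l * (eVariationOn f Set.univ).toReal) ∧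
      ∀ x, g x - average lam l g x = f x - ∫ y, f y ∂ν := by
  set V := (eVariationOn f Set.univ).toReal
  set m := ∫ y, f y ∂ν
  set r : ℝ := 1 - ((2 : ℝ) ^ l)⁻¹ with hr
  have hr0 : 0 ≤ r := sub_nonneg.2 (inv_le_one_of_one_le₀ (one_le_pow₀ one_le_two))
  have hr1 : r < 1 := sub_lt_self _ (by positivity)
  let a : ℕ → interval lam → ℝ := fun k x => (average lam l)^[k] f x - m
  have ha : ∀ k x, ‖a k x‖ ≤ r ^ k * V := abs_iterate_average_sub_integral_le hl hf hν
  have hgeom : HasSum (fun k => r ^ k * V) (2 ^ l * V) := by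
    have := (hasSum_geometric_of_lt_one hr0 hr1).mul_right V
    rwa [hr, sub_sub_cancel, inv_inv] at this
  have hsum : ∀ x, Summable fun k => a k x := fun x =>
    Summable.of_norm_bounded hgeom.summable fun k => ha k x
  have hmeas : ∀ k, Measurable (a k) := fun k =>
    (boundedVariationOn_iterate_average hl hf k).measurable.sub_const m
  refine ⟨fun x => ∑' k, a k x, Measurable.tsum hmeas,
    fun x => tsum_of_norm_bounded hgeom fun k => ha k x, fun x => ?_⟩
  have hstep : ∀ k, average lam l (a k) x = a (k + 1) x := fun k => by
    have := average_add lam l ((average lam l)^[k] f) (fun _ => -m) x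
    rw [average_const] at this
    simp only [a, Function.iterate_succ_apply', sub_eq_add_neg]
    exact this
  have havg : HasSum (fun k => a (k + 1) x) (average lam l (fun y => ∑' k, a k y) x) := by
    simp only [← hstep]
    exact (hasSum_sum fun w _ => (hsum (wordMap lam w x)).hasSum).mul_left _
  change ∑' k, a k x - _ = a 0 x
  rw [(hsum x).tsum_eq_zero_add, havg.tsum_eq, add_sub_cancel_right]

theorem average_exp_sub_sq_le {lam : Set.Ioo (0 : ℝ) 1} {l : ℕ} {G : interval lam → ℝ}
    {ε D : ℝ} (hε : ε ≤ 1 / 2) (hG : ∀ x, |G x| ≤ ε) (hD : ∀ x, |G x - average lam l G x| ≤ D)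
    (x : interval lam) :
    average lam l (fun y => Real.exp (G y - (1 / 2 + 2 * ε) * G y ^ 2)) x
      ≤ Real.exp (average lam l G x - (1 / 2 + 2 * ε) * G x ^ 2 + (ε * D + 4 * ε ^ 3)) := by
  have hL := abs_average_le lam l hG
  have hε0 : 0 ≤ ε := (abs_nonneg _).trans (hG x)
  calc average lam l (fun y => Real.exp (G y - (1 / 2 + 2 * ε) * G y ^ 2)) x
      ≤ average lam l (fun y => 1 + G y) x :=
        average_mono lam l (fun y => exp_sub_sq_le_one_add hε (hG y)) x
    _ = 1 + average lam l G x := by rw [average_add, average_const]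
    _ ≤ Real.exp (average lam l G x - (1 / 2 - 2 * ε) * average lam l G x ^ 2) :=
        one_add_le_exp_sub_sq hε (hL x)
    _ ≤ _ := by
        refine Real.exp_le_exp.2 ?_
        have h1 : G x ^ 2 ≤ ε ^ 2 := sq_le_sq' (abs_le.1 (hG x)).1 (abs_le.1 (hG x)).2
        have h2 : average lam l G x ^ 2 ≤ ε ^ 2 :=
          sq_le_sq' (abs_le.1 (hL x)).1 (abs_le.1 (hL x)).2
        -- Half of G² - (LG)² gives εD; the corrections 2ε(G² + (LG)²) give 4ε³.
        have h3 : (G x - average lam l G x) * (G x + average lam l G x) ≤ D * (2 * ε) := by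
          refine (le_abs_self _).trans ?_
          rw [abs_mul]
          have hadd : |G x + average lam l G x| ≤ 2 * ε :=
            (abs_add_le _ _).trans (by linarith [hG x, hL x])
          exact mul_le_mul (hD x) hadd (abs_nonneg _) ((abs_nonneg _).trans (hD x))
        nlinarith [mul_le_mul_of_nonneg_left h1 hε0, mul_le_mul_of_nonneg_left h2 hε0]

theorem IsMarkovChain.measureReal_le_sum_le {Ω : Type*} [MeasurableSpace Ω] {P : Measure Ω}
    [IsProbabilityMeasure P] {lam : Set.Ioo (0 : ℝ) 1} {l : ℕ} {μ : Measure (interval lam)}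
    {X : ℕ → Ω → interval lam} (hX : IsMarkovChain X μ (kernel lam l) P)
    {g : interval lam → ℝ} (hg : Measurable g) {N t : ℝ} (ht : 0 ≤ t)
    (hgN : ∀ x, |g x| ≤ 2 ^ l * N) (hN : ∀ x, |g x - average lam l g x| ≤ N)
    (htN : t * (2 ^ l * N) ≤ 1 / 24) (n : ℕ) (s : ℝ) :
    P.real {ω | s ≤ ∑ k ∈ Finset.Icc 1 n, (g (X k ω) - average lam l g (X k ω))}
      ≤ 1.244 * Real.exp (n * (t ^ 2 * N ^ 2 * 2 ^ l * (1 + 4 * (t * N * 4 ^ l))) - t * s) := by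
  set ε := t * (2 ^ l * N) with hε
  have hav : ∀ x, average lam l (fun y => t * g y) x = t * average lam l g x :=
    average_const_mul lam l t g
  have hG : ∀ x, |t * g x| ≤ ε := fun x => by
    rw [abs_mul, abs_of_nonneg ht]
    exact mul_le_mul_of_nonneg_left (hgN x) ht
  have hD : ∀ x, |t * g x - average lam l (fun y => t * g y) x| ≤ t * N := fun x => by
    rw [hav, ← mul_sub, abs_mul, abs_of_nonneg ht]
    exact mul_le_mul_of_nonneg_left (hN x) ht
  let u : interval lam → ℝ := fun x =>
    average lam l (fun y => t * g y) x - (1 / 2 + 2 * ε) * (t * g x) ^ 2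
  let w : interval lam → ℝ := fun x => t * g x - average lam l (fun y => t * g y) x
  have hGm : Measurable fun x => t * g x := hg.const_mul t
  have hAm := measurable_average lam l hGm
  have hu : Measurable u := hAm.sub ((hGm.pow_const 2).const_mul _)
  have hU : ∀ x, |u x| ≤ 1 / 20 := fun x => by
    have hε0 : 0 ≤ ε := (abs_nonneg _).trans (hG x)
    have h1 : (t * g x) ^ 2 ≤ ε ^ 2 := sq_le_sq' (abs_le.1 (hG x)).1 (abs_le.1 (hG x)).2
    have h2 := abs_average_le lam l hG x
    have h3 : (1 / 2 + 2 * ε) * (t * g x) ^ 2 ≤ (1 / 2 + 2 * (1 / 24)) * (1 / 24) ^ 2 :=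
      mul_le_mul (by linarith) (h1.trans (by gcongr)) (sq_nonneg _) (by norm_num)
    refine (abs_sub _ _).trans ?_
    rw [abs_of_nonneg (by positivity : 0 ≤ (1 / 2 + 2 * ε) * (t * g x) ^ 2)]
    linarith
  have hwm : Measurable w := hGm.sub hAm
  have h := hX.measureReal_le_sum_le_exp hwm hu hU
    (c := ε * (t * N) + 4 * ε ^ 3) (fun x => by
      rw [lintegral_kernel_ofReal _ _ fun _ => Real.exp_nonneg _]
      refine ENNReal.ofReal_le_ofReal (le_trans (le_of_eq ?_)
        (average_exp_sub_sq_le (by linarith) hG hD x))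
      congr 1
      funext y
      simp only [u, w]
      congr 1
      ring) n (t * s)
  have hset : {ω | s ≤ ∑ k ∈ Finset.Icc 1 n, (g (X k ω) - average lam l g (X k ω))}
      ⊆ {ω | t * s ≤ ∑ k ∈ Finset.Icc 1 n, w (X k ω)} := fun ω hω => by
    have : ∑ k ∈ Finset.Icc 1 n, w (X k ω)
        = t * ∑ k ∈ Finset.Icc 1 n, (g (X k ω) - average lam l g (X k ω)) := by
      simp only [w, hav, ← mul_sub, Finset.mul_sum]
    rw [Set.mem_ofPred_eq, this]
    exact mul_le_mul_of_nonneg_left hω ht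
  refine (measureReal_mono hset).trans (h.trans ?_)
  -- Here e^{0.1} ≤ 1/(1 - 0.1) < 1.12, well below the required constant.
  have hexp : Real.exp (2 * (1 / 20)) ≤ 1.244 :=
    (Real.exp_bound_div_one_sub_of_interval (by norm_num) (by norm_num)).trans (by norm_num)
  rw [add_sub_assoc, Real.exp_add]
  have h4 : (4 : ℝ) ^ l = 2 ^ l * 2 ^ l := by rw [← mul_pow]; norm_num
  have hc : ε * (t * N) + 4 * ε ^ 3 = t ^ 2 * N ^ 2 * 2 ^ l * (1 + 4 * (t * N * 4 ^ l)) := by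
    rw [hε, h4]
    ring
  rw [hc]
  gcongr

/-- With q = 2^l, this t makes ta twice the target exponent, so the quadratic cost may use up half
of it. -/
theorem exp_rate_le {q N a : ℝ} (hq : 1 ≤ q) (ha0 : 0 < a) (ha : a < N / (3 * (2 * q - 1))) :
    let t := 2 * a / (N ^ 2 * (16.65 * q + 5.12))
    t * (q * N) ≤ 1 / 24 ∧
      t ^ 2 * N ^ 2 * q * (1 + 4 * (t * N * q ^ 2)) - t * a
        ≤ -(a ^ 2 / (N ^ 2 * (16.65 * q + 5.12))) := by
  intro t
  set B := 16.65 * q + 5.12 with hB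
  have htB : t = 2 * a / (N ^ 2 * B) := rfl
  have hB0 : 0 < B := by positivity
  have hd : 0 < 3 * (2 * q - 1) := by linarith
  have hN : 0 < N := by
    rw [lt_div_iff₀ hd] at ha
    exact (mul_pos ha0 hd).trans ha
  -- Uses 2q - 1 ≥ q; then tNq² ≤ (2/3)/16.65 < 1/24.
  have haN : a * (3 * q) ≤ N := by
    rw [lt_div_iff₀ hd] at ha
    nlinarith
  have htN : t * N * q ^ 2 ≤ 1 / 24 := by
    have : t * N * q ^ 2 = 2 * (a * q) * q / (N * B) := by
      rw [htB]
      field_simp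
    rw [this, div_le_iff₀ (by positivity)]
    nlinarith [mul_le_mul_of_nonneg_right haN (by linarith : 0 ≤ q), mul_pos hN hB0]
  have hpos : 0 < t := by positivity
  refine ⟨?_, ?_⟩
  · nlinarith [mul_pos (mul_pos hpos hN) (by linarith : 0 < q)]
  -- 7/6 = 1 + 4/24; what then remains is 14q/3 ≤ B.
  · have h1 : t ^ 2 * N ^ 2 * q * (1 + 4 * (t * N * q ^ 2)) ≤ t ^ 2 * N ^ 2 * q * (7 / 6) := by
      gcongr
      linarith
    have h2 : t ^ 2 * N ^ 2 * q * (7 / 6) - t * a + a ^ 2 / (N ^ 2 * B)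
        = a ^ 2 / (N ^ 2 * B ^ 2) * (14 / 3 * q - B) := by
      rw [htB]
      field_simp
      ring
    have h3 : a ^ 2 / (N ^ 2 * B ^ 2) * (14 / 3 * q - B) ≤ 0 :=
      mul_nonpos_of_nonneg_of_nonpos (by positivity) (by linarith)
    linarith

/-- The two tails are the one-sided bound for g and for -g, whence 2.488 = 2 · 1.244. -/
theorem IsMarkovChain.measureReal_le_abs_mean_sub_le {Ω : Type*} [MeasurableSpace Ω]
    {P : Measure Ω} [IsProbabilityMeasure P] {lam : Set.Ioo (0 : ℝ) 1} {l : ℕ}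
    (hl : (lam : ℝ) ^ l < 1 / 2) {μ ν : Measure (interval lam)} [IsProbabilityMeasure ν]
    (hν : (kernel lam l).Invariant ν) {X : ℕ → Ω → interval lam}
    (hX : IsMarkovChain X μ (kernel lam l) P) {f : interval lam → ℝ}
    (hf : BoundedVariationOn f Set.univ) {a : ℝ} (ha0 : 0 < a)
    (ha : a < bvNorm f / (3 * (2 ^ (l + 1) - 1))) {n : ℕ} (hn : n ≠ 0) :
    P.real {ω | a ≤ |1 / (n : ℝ) * ∑ k ∈ Finset.Icc 1 n, f (X k ω) - ∫ x, f x ∂ν|}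
      ≤ 2.488 * Real.exp (-(n * a ^ 2 / (bvNorm f ^ 2 * (16.65 * 2 ^ l + 5.12)))) := by
  obtain ⟨g, hg, hgV, hfg⟩ := exists_sub_average_eq hl hf hν
  set N := bvNorm f with hN
  have hVN : (eVariationOn f Set.univ).toReal ≤ N :=
    le_add_of_nonneg_left (Real.iSup_nonneg fun _ => abs_nonneg _)
  have hgN : ∀ x, |g x| ≤ 2 ^ l * N := fun x => (hgV x).trans (by gcongr)
  have hfN : ∀ x, |g x - average lam l g x| ≤ N := fun x => by
    rw [hfg]
    exact (abs_sub_integral_le hf ν x).trans hVN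
  obtain ⟨ht, hrate⟩ := exp_rate_le (one_le_pow₀ one_le_two : (1 : ℝ) ≤ 2 ^ l) ha0
    (by rwa [pow_succ'] at ha)
  set t := 2 * a / (N ^ 2 * (16.65 * 2 ^ l + 5.12)) with ht_def
  have ht0 : 0 ≤ t := by positivity
  have hn0 : (0 : ℝ) < n := by exact_mod_cast Nat.pos_of_ne_zero hn
  have hexp : n * (t ^ 2 * N ^ 2 * 2 ^ l * (1 + 4 * (t * N * 4 ^ l))) - t * (n * a)
      ≤ -(n * a ^ 2 / (N ^ 2 * (16.65 * 2 ^ l + 5.12))) := by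
    have h4 : (4 : ℝ) ^ l = (2 ^ l) ^ 2 := by rw [← pow_mul, mul_comm, pow_mul]; norm_num
    have := mul_le_mul_of_nonneg_left hrate hn0.le
    rw [h4, mul_div_assoc]
    linarith
  have h1 := hX.measureReal_le_sum_le hg ht0 hgN hfN ht n (n * a)
  have hneg : ∀ x, average lam l (fun y => -g y) x = -average lam l g x := fun x => by
    simpa using average_const_mul lam l (-1) g x
  have h2 := hX.measureReal_le_sum_le hg.neg ht0 (fun x => by simpa using hgN x)
    (fun x => by
      have := hneg x
      simp only [Pi.neg_def, this]
      rw [← abs_neg]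
      simpa [sub_eq_add_neg, add_comm] using hfN x) ht n (n * a)
  have hset : {ω | a ≤ |1 / (n : ℝ) * ∑ k ∈ Finset.Icc 1 n, f (X k ω) - ∫ x, f x ∂ν|}
      ⊆ {ω | n * a ≤ ∑ k ∈ Finset.Icc 1 n, (g (X k ω) - average lam l g (X k ω))} ∪
        {ω | n * a ≤ ∑ k ∈ Finset.Icc 1 n, ((-g) (X k ω) - average lam l (-g) (X k ω))} := by
    intro ω hω
    have hS : ∑ k ∈ Finset.Icc 1 n, (g (X k ω) - average lam l g (X k ω))
        = n * (1 / (n : ℝ) * ∑ k ∈ Finset.Icc 1 n, f (X k ω) - ∫ x, f x ∂ν) := by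
      simp only [hfg, Finset.sum_sub_distrib, Finset.sum_const, Nat.card_Icc, nsmul_eq_mul,
        Nat.add_sub_cancel]
      field_simp
    have hS' : ∑ k ∈ Finset.Icc 1 n, ((-g) (X k ω) - average lam l (-g) (X k ω))
        = -∑ k ∈ Finset.Icc 1 n, (g (X k ω) - average lam l g (X k ω)) := by
      rw [← Finset.sum_neg_distrib]
      refine Finset.sum_congr rfl fun k _ => ?_
      rw [Pi.neg_def, hneg]
      ring
    rw [Set.mem_union, Set.mem_ofPred_eq, Set.mem_ofPred_eq, hS', hS, ← mul_neg]
    exact (le_abs.1 (Set.mem_ofPred_eq ▸ hω)).imp (fun h => by gcongr) (fun h => by gcongr)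
  refine (measureReal_mono hset).trans ((measureReal_union_le _ _).trans
    ((add_le_add h1 h2).trans ?_))
  have := Real.exp_le_exp.2 hexp
  linarith

end BernoulliChain

theorem mainTheorem7 (lam : Set.Ioo (0 : ℝ) 1) (hlam : 1 / 2 < (lam : ℝ)) (l : ℕ)
    (hl : (lam : ℝ) ^ l < 1 / 2) :
    -- the Bernoulli convolution is the unique stationary probability measure of the chain
    (BernoulliChain.kernel lam l).Invariant (BernoulliChain.bernoulliConvolution lam) ∧
    (∀ ν : Measure (BernoulliChain.interval lam), IsProbabilityMeasure ν →
      (BernoulliChain.kernel lam l).Invariant ν → ν = BernoulliChain.bernoulliConvolution lam) ∧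
    -- the concentration inequality
    ∀ {Ω : Type*} [MeasurableSpace Ω] (P : Measure Ω) [IsProbabilityMeasure P]
      (μ : Measure (BernoulliChain.interval lam)) (X : ℕ → Ω → BernoulliChain.interval lam),
      BernoulliChain.IsMarkovChain X μ (BernoulliChain.kernel lam l) P →
      ∀ φ : BernoulliChain.interval lam → ℝ, BoundedVariationOn φ Set.univ →
      ∀ a : ℝ, 0 < a → a < BernoulliChain.bvNorm φ / (3 * (2 ^ (l + 1) - 1)) →
      ∀ n : ℕ, 120 * 2 ^ l ≤ n →
        P.real {ω | a ≤ |1 / (n : ℝ) * ∑ k ∈ Finset.Icc 1 n, φ (X k ω)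
            - ∫ x, φ x ∂(BernoulliChain.bernoulliConvolution lam)|}
          ≤ 2.488 * Real.exp (-(n * a ^ 2 /
              (BernoulliChain.bvNorm φ ^ 2 * (16.65 * 2 ^ l + 5.12)))) := by
  have hinv := BernoulliChain.invariant_bernoulliConvolution lam l
  refine ⟨hinv, fun ν _ hν => BernoulliChain.Invariant.unique hl hν hinv, ?_⟩
  intro Ω _ P _ μ X hX φ hφ a ha0 ha n hn
  exact hX.measureReal_le_abs_mean_sub_le hl hinv hφ ha0 ha
    ((Nat.mul_pos (by norm_num) (by positivity)).trans_le hn).ne'
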